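/- Let $(M,g)$ be a connected, finite-dimensional smooth Riemannian manifold (without boundary) with Riemannian distance $d$ and Levi-Civita connection $\nabla$. Let $F$ be a complete smooth vector field on $M$ with flow $\varphi_t$, and suppose there is a constant $L>0$ such that $\|\nabla F\|_g\le L$, i.e. at every point $x\in M$ the linear map $T_xM\to T_xM$, $v\mapsto\nabla_vF$, has operator norm at most $L$ with respect to $g$. Let $\psi_h:M\to M$ be a numerical one-step method with step size $h>0$ whose local error satisfies, for some $p\in\mathbb N$ and some constant $C$, $$d(\psi_h(u),\varphi_h(u))\le C\,h^{p+1}\quad\text{for all }u\in M.$$ Let $u^0\in M$, let $u(t)=\varphi_t(u^0)$ be the exact solution of $\dot u=F(u)$, $u(0)=u^0$, and let $u^{k+1}=\psi_h(u^k)$ for $k\ge 0$ be the numerical solution. Then the global error satisfies $$d\bigl(u(kh),u^k\bigr)\le\frac{C}{L}\bigl(e^{khL}-1\bigr)h^p\quad\text{for all integers }k>0.$$ -/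

import Mathlib

open Bundle Manifold Set Filter Topology
open scoped ContDiff

set_option linter.unusedSectionVars false

noncomputable section
namespace RiemannianError

section LeviCivita

variable {E : Type*} [NormedAddCommGroup E] [NormedSpace ℝ E] [FiniteDimensional ℝ E]
  {H : Type*} [TopologicalSpace H] {I : ModelWithCorners ℝ E H}
  {M : Type*} [TopologicalSpace M] [ChartedSpace H M] [IsManifold I ∞ M]
  [RiemannianBundle (fun x : M ↦ TangentSpace I x)]

variable (I) in
/-- The right-hand side of the Koszul formula, which is `2 g(∇_X Y, Z)` at the point `x`:
`X g(Y, Z) + Y g(X, Z) - Z g(X, Y) + g([X, Y], Z) - g([X, Z], Y) - g([Y, Z], X)`. -/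
def koszul (X Y Z : Π x : M, TangentSpace I x) (x : M) : ℝ :=
  d% (fun y ↦ inner ℝ (Y y) (Z y)) x (X x)
    + d% (fun y ↦ inner ℝ (X y) (Z y)) x (Y x)
    - d% (fun y ↦ inner ℝ (X y) (Y y)) x (Z x)
    + inner ℝ (VectorField.mlieBracket I X Y x) (Z x)
    - inner ℝ (VectorField.mlieBracket I X Z x) (Y x)
    - inner ℝ (VectorField.mlieBracket I Y Z x) (X x)

variable [IsContMDiffRiemannianBundle I ∞ E (fun x : M ↦ TangentSpace I x)]

lemma mdiff_inner {X Y : Π x : M, TangentSpace I x} {x : M} (hX : MDiffAt (T% X) x)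
    (hY : MDiffAt (T% Y) x) : MDiffAt (fun y ↦ inner ℝ (X y) (Y y)) x :=
  MDifferentiableAt.inner_bundle (IB := I) (F := E) (E := fun x : M ↦ TangentSpace I x) (b := id)
    (v := X) (w := Y) hX hY

lemma koszul_tensorial_right {X Y : Π x : M, TangentSpace I x} {x : M}
    (hX : MDiffAt (T% X) x) (hY : MDiffAt (T% Y) x) :
    TensorialAt I E (fun Z ↦ koszul I X Y Z x) x where
  smul {f Z} hf hZ := by
    have : CompleteSpace E := FiniteDimensional.complete ℝ E
    have h1 := mvfderiv_mul hf (mdiff_inner hX hZ)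
    have h2 := mvfderiv_mul hf (mdiff_inner hY hZ)
    have e1 : (fun y ↦ inner ℝ (X y) ((f • Z) y)) = f * fun y ↦ inner ℝ (X y) (Z y) := by
      ext y; simp [inner_smul_right]
    have e2 : (fun y ↦ inner ℝ (Y y) ((f • Z) y)) = f * fun y ↦ inner ℝ (Y y) (Z y) := by
      ext y; simp [inner_smul_right]
    simp only [koszul, e1, e2, h1, h2, VectorField.mlieBracket_smul_right hf hZ]
    simp [inner_smul_right, inner_smul_left, inner_add_left]
    simp only [real_inner_comm]
    ring
  add {Z Z'} hZ hZ' := by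
    have : CompleteSpace E := FiniteDimensional.complete ℝ E
    have h1 := mvfderiv_add (mdiff_inner hX hZ) (mdiff_inner hX hZ')
    have h2 := mvfderiv_add (mdiff_inner hY hZ) (mdiff_inner hY hZ')
    have e1 : (fun y ↦ inner ℝ (X y) ((Z + Z') y)) =
        (fun y ↦ inner ℝ (X y) (Z y)) + fun y ↦ inner ℝ (X y) (Z' y) := by
      ext y; simp [inner_add_right]
    have e2 : (fun y ↦ inner ℝ (Y y) ((Z + Z') y)) =
        (fun y ↦ inner ℝ (Y y) (Z y)) + fun y ↦ inner ℝ (Y y) (Z' y) := by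
      ext y; simp [inner_add_right]
    simp only [koszul, e1, e2, h1, h2, VectorField.mlieBracket_add_right hZ hZ']
    simp [inner_add_left, inner_add_right]
    ring


lemma koszul_tensorial_left {Y Z : Π x : M, TangentSpace I x} {x : M}
    (hY : MDiffAt (T% Y) x) (hZ : MDiffAt (T% Z) x) :
    TensorialAt I E (fun X ↦ koszul I X Y Z x) x where
  smul {f X} hf hX := by
    have : CompleteSpace E := FiniteDimensional.complete ℝ E
    have h1 := mvfderiv_mul hf (mdiff_inner hX hZ)
    have h2 := mvfderiv_mul hf (mdiff_inner hX hY)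
    have e1 : (fun y ↦ inner ℝ ((f • X) y) (Z y)) = f * fun y ↦ inner ℝ (X y) (Z y) := by
      ext y; simp [inner_smul_left]
    have e2 : (fun y ↦ inner ℝ ((f • X) y) (Y y)) = f * fun y ↦ inner ℝ (X y) (Y y) := by
      ext y; simp [inner_smul_left]
    simp only [koszul, e1, e2, h1, h2, VectorField.mlieBracket_smul_left hf hX]
    simp [inner_smul_right, inner_smul_left, inner_add_left]
    ring
  add {X X'} hX hX' := by
    have : CompleteSpace E := FiniteDimensional.complete ℝ E
    have h1 := mvfderiv_add (mdiff_inner hX hZ) (mdiff_inner hX' hZ)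
    have h2 := mvfderiv_add (mdiff_inner hX hY) (mdiff_inner hX' hY)
    have e1 : (fun y ↦ inner ℝ ((X + X') y) (Z y)) =
        (fun y ↦ inner ℝ (X y) (Z y)) + fun y ↦ inner ℝ (X' y) (Z y) := by
      ext y; simp [inner_add_left]
    have e2 : (fun y ↦ inner ℝ ((X + X') y) (Y y)) =
        (fun y ↦ inner ℝ (X y) (Y y)) + fun y ↦ inner ℝ (X' y) (Y y) := by
      ext y; simp [inner_add_left]
    simp only [koszul, e1, e2, h1, h2, VectorField.mlieBracket_add_left hX hX']
    simp [inner_add_left, inner_add_right]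
    ring

lemma koszul_add {X Y Y' Z : Π x : M, TangentSpace I x} {x : M} (hX : MDiffAt (T% X) x)
    (hY : MDiffAt (T% Y) x) (hY' : MDiffAt (T% Y') x) (hZ : MDiffAt (T% Z) x) :
    koszul I X (Y + Y') Z x = koszul I X Y Z x + koszul I X Y' Z x := by
  have : CompleteSpace E := FiniteDimensional.complete ℝ E
  have h1 := mvfderiv_add (mdiff_inner hY hZ) (mdiff_inner hY' hZ)
  have h2 := mvfderiv_add (mdiff_inner hX hY) (mdiff_inner hX hY')
  have e1 : (fun y ↦ inner ℝ ((Y + Y') y) (Z y)) =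
      (fun y ↦ inner ℝ (Y y) (Z y)) + fun y ↦ inner ℝ (Y' y) (Z y) := by
    ext y; simp [inner_add_left]
  have e2 : (fun y ↦ inner ℝ (X y) ((Y + Y') y)) =
      (fun y ↦ inner ℝ (X y) (Y y)) + fun y ↦ inner ℝ (X y) (Y' y) := by
    ext y; simp [inner_add_right]
  simp only [koszul, e1, e2, h1, h2, VectorField.mlieBracket_add_right hY hY',
    VectorField.mlieBracket_add_left hY hY']
  simp [inner_add_left, inner_add_right]
  ring

lemma koszul_smul {f : M → ℝ} {X Y Z : Π x : M, TangentSpace I x} {x : M} (hf : MDiffAt f x)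
    (hX : MDiffAt (T% X) x) (hY : MDiffAt (T% Y) x) (hZ : MDiffAt (T% Z) x) :
    koszul I X (f • Y) Z x =
      f x * koszul I X Y Z x + 2 * (d% f x (X x) * inner ℝ (Y x) (Z x)) := by
  have : CompleteSpace E := FiniteDimensional.complete ℝ E
  have h1 := mvfderiv_mul hf (mdiff_inner hY hZ)
  have h2 := mvfderiv_mul hf (mdiff_inner hX hY)
  have e1 : (fun y ↦ inner ℝ ((f • Y) y) (Z y)) = f * fun y ↦ inner ℝ (Y y) (Z y) := by
    ext y; simp [inner_smul_left]
  have e2 : (fun y ↦ inner ℝ (X y) ((f • Y) y)) = f * fun y ↦ inner ℝ (X y) (Y y) := by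
    ext y; simp [inner_smul_right]
  simp only [koszul, e1, e2, h1, h2, VectorField.mlieBracket_smul_right hf hY,
    VectorField.mlieBracket_smul_left hf hY]
  simp [inner_smul_right, inner_smul_left, inner_add_left]
  simp only [real_inner_comm]
  ring

variable (I) in
lemma koszul_torsion (X Y Z : Π x : M, TangentSpace I x) (x : M) :
    koszul I X Y Z x - koszul I Y X Z x =
      2 * inner ℝ (VectorField.mlieBracket I X Y x) (Z x) := by
  have e : (fun y ↦ inner ℝ (Y y) (X y)) = fun y ↦ inner ℝ (X y) (Y y) := by
    ext y; exact real_inner_comm _ _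
  simp only [koszul, e, VectorField.mlieBracket_swap_apply (V := Y) (W := X), inner_neg_left]
  ring

variable (I) in
lemma koszul_metric (X Y Z : Π x : M, TangentSpace I x) (x : M) :
    koszul I X Y Z x + koszul I X Z Y x = 2 * d% (fun y ↦ inner ℝ (Y y) (Z y)) x (X x) := by
  have e : (fun y ↦ inner ℝ (Z y) (Y y)) = fun y ↦ inner ℝ (Y y) (Z y) := by
    ext y; exact real_inner_comm _ _
  simp only [koszul, e, VectorField.mlieBracket_swap_apply (V := Z) (W := Y), inner_neg_left]
  ring

/-- For `Y` differentiable at `x`, the Koszul expression depends on `X` and `Z` only through their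
values at `x`, and defines the bilinear form `(v, w) ↦ 2 g(∇_v Y, w)` on the tangent space. -/
def koszulForm (Y : Π x : M, TangentSpace I x) (x : M) (hY : MDiffAt (T% Y) x) :
    TangentSpace I x →L[ℝ] TangentSpace I x →L[ℝ] ℝ :=
  TensorialAt.mkHom₂ (fun X Z ↦ koszul I X Y Z x) x
    (fun _ hZ ↦ koszul_tensorial_left hY hZ) (fun _ hX ↦ koszul_tensorial_right hX hY)

lemma koszulForm_apply {X Y Z : Π x : M, TangentSpace I x} {x : M} (hX : MDiffAt (T% X) x)
    (hY : MDiffAt (T% Y) x) (hZ : MDiffAt (T% Z) x) :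
    koszulForm Y x hY (X x) (Z x) = koszul I X Y Z x :=
  TensorialAt.mkHom₂_apply _ _ hX hZ

instance finiteDimensional_tangentSpace (x : M) : FiniteDimensional ℝ (TangentSpace I x) :=
  inferInstanceAs (FiniteDimensional ℝ E)

open Classical in
/-- `leviCivitaFun Y x v` is `∇_v Y`: the vector with `2 g(∇_v Y, w)` equal to the Koszul form. By
convention it is `0` if `Y` is not differentiable at `x`. -/
def leviCivitaFun (Y : Π x : M, TangentSpace I x) (x : M) :
    TangentSpace I x →L[ℝ] TangentSpace I x :=
  if hY : MDiffAt (T% Y) x then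
    haveI : CompleteSpace (TangentSpace I x) := FiniteDimensional.complete ℝ _
    LinearMap.toContinuousLinearMap
      { toFun v := (1 / 2 : ℝ) • (InnerProductSpace.toDual ℝ (TangentSpace I x)).symm
          (koszulForm Y x hY v)
        map_add' v w := by simp
        map_smul' c v := by simp [smul_comm c] }
  else 0

/-- The Koszul formula. -/
lemma inner_leviCivitaFun {X Y Z : Π x : M, TangentSpace I x} {x : M} (hX : MDiffAt (T% X) x)
    (hY : MDiffAt (T% Y) x) (hZ : MDiffAt (T% Z) x) :
    2 * inner ℝ (leviCivitaFun Y x (X x)) (Z x) = koszul I X Y Z x := by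
  have : CompleteSpace (TangentSpace I x) := FiniteDimensional.complete ℝ _
  rw [← koszulForm_apply hX hY hZ, leviCivitaFun, dif_pos hY]
  simp [inner_smul_left]

lemma leviCivitaFun_ext {x : M} {A B : TangentSpace I x →L[ℝ] TangentSpace I x}
    (h : ∀ X Z : Π x : M, TangentSpace I x, MDiffAt (T% X) x → MDiffAt (T% Z) x →
      2 * inner ℝ (A (X x)) (Z x) = 2 * inner ℝ (B (X x)) (Z x)) : A = B := by
  ext v
  refine ext_inner_right ℝ fun w ↦ ?_
  have := h (FiberBundle.extend E v) (FiberBundle.extend E w)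
    (FiberBundle.mdifferentiableAt_extend ..) (FiberBundle.mdifferentiableAt_extend ..)
  simpa using this

variable (I M) in
/-- The Levi-Civita connection of a Riemannian manifold; `leviCivita I M Y x v` is `∇_v Y`, so that
`leviCivita I M Y x` is the endomorphism `v ↦ ∇_v Y` of the tangent space at `x`. -/
def leviCivita : CovariantDerivative I E (fun x : M ↦ TangentSpace I x) where
  toFun := leviCivitaFun
  isCovariantDerivativeOnUniv :=
    { add := fun {Y Y' x} hY hY' _ ↦ leviCivitaFun_ext fun X Z hX hZ ↦ by
        have hs : MDiffAt (T% (Y + Y')) x := mdifferentiableAt_add_section hY hY'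
        rw [inner_leviCivitaFun hX hs hZ, koszul_add hX hY hY' hZ, add_apply,
          inner_add_left, mul_add, inner_leviCivitaFun hX hY hZ, inner_leviCivitaFun hX hY' hZ]
      leibniz := fun {Y f x} hY hf _ ↦ leviCivitaFun_ext fun X Z hX hZ ↦ by
        have hs : MDiffAt (T% (f • Y)) x := hf.smul_section hY
        rw [inner_leviCivitaFun hX hs hZ, koszul_smul hf hX hY hZ, ← inner_leviCivitaFun hX hY hZ]
        simp [inner_add_left, inner_smul_left]
        ring }

/-- The Levi-Civita connection is torsion-free. -/
theorem leviCivita_torsion [CompleteSpace E] : (leviCivita I M).torsion = 0 := by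
  rw [CovariantDerivative.torsion_eq_zero_iff]
  intro X Y x hX hY
  refine ext_inner_right ℝ fun w ↦ ?_
  have hw : MDiffAt (T% (FiberBundle.extend E w)) x := FiberBundle.mdifferentiableAt_extend ..
  have h1 := inner_leviCivitaFun hX hY hw
  have h2 := inner_leviCivitaFun hY hX hw
  have h3 := koszul_torsion I X Y (FiberBundle.extend E w) x
  rw [← h1, ← h2] at h3
  simp at h3
  rw [inner_sub_left]
  change inner ℝ (leviCivitaFun Y x (X x)) w - inner ℝ (leviCivitaFun X x (Y x)) w = _
  linarith

/-- The Levi-Civita connection is compatible with the metric. -/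
theorem leviCivita_metric {X Y Z : Π x : M, TangentSpace I x} {x : M} (hX : MDiffAt (T% X) x)
    (hY : MDiffAt (T% Y) x) (hZ : MDiffAt (T% Z) x) :
    d% (fun y ↦ inner ℝ (Y y) (Z y)) x (X x) =
      inner ℝ (leviCivita I M Y x (X x)) (Z x) + inner ℝ (Y x) (leviCivita I M Z x (X x)) := by
  have h1 := inner_leviCivitaFun hX hY hZ
  have h2 := inner_leviCivitaFun hX hZ hY
  have h3 := koszul_metric I X Y Z x
  rw [← h1, ← h2, real_inner_comm (Y x)] at h3
  change _ = inner ℝ (leviCivitaFun Y x (X x)) (Z x) + inner ℝ (Y x) (leviCivitaFun Z x (X x))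
  linarith

end LeviCivita

section Flow

variable {E : Type*} [NormedAddCommGroup E] [NormedSpace ℝ E]
  {H : Type*} [TopologicalSpace H] {I : ModelWithCorners ℝ E H}
  {M : Type*} [TopologicalSpace M] [ChartedSpace H M]

/-- A vector field is complete if through every point there is an integral curve defined for all
real times. -/
def IsCompleteVectorField (F : Π x : M, TangentSpace I x) : Prop :=
  ∀ x : M, ∃ γ : ℝ → M, γ 0 = x ∧ IsMIntegralCurve γ F

/-- The flow of a complete vector field: `t ↦ flow hF t x` is the integral curve of `F` which is
at `x` at time `0`. It is unique when `F` is smooth and `M` is Hausdorff without boundary. -/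
def flow {F : Π x : M, TangentSpace I x} (hF : IsCompleteVectorField F) (t : ℝ) (x : M) : M :=
  (hF x).choose t

variable {F : Π x : M, TangentSpace I x} (hF : IsCompleteVectorField F)

theorem flow_zero (x : M) : flow hF 0 x = x := (hF x).choose_spec.1

theorem isMIntegralCurve_flow (x : M) : IsMIntegralCurve (fun t ↦ flow hF t x) F :=
  (hF x).choose_spec.2

/-- The flow is the only solution of the initial value problem. -/
theorem eq_flow [I.Boundaryless] [T2Space M] [IsManifold I 1 M] [CompleteSpace E]
    (hs : ContMDiff I I.tangent 1 (fun x ↦ (⟨x, F x⟩ : TangentBundle I M)))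
    {γ : ℝ → M} (hγ : IsMIntegralCurve γ F) (t : ℝ) : γ t = flow hF t (γ 0) :=
  congrFun (isMIntegralCurve_Ioo_eq_of_contMDiff_boundaryless (t₀ := 0) hs hγ
    (isMIntegralCurve_flow hF (γ 0)) (flow_zero hF (γ 0)).symm) t

end Flow

end RiemannianError

end

/-! With e_k the error after k steps, comparing both φ_h(u(kh)) and ψ_h(u^k) with φ_h(u^k) gives
e_{k+1} ≤ exp(Lh) e_k + C h^{p+1}, and `le_of_forall_succ_le_exp_mul_add` solves this recursion. The
geometric content is the Lipschitz constant exp(LT) of the time-T flow, `dist_flow_le`.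

Infinitesimally, the Lie derivative of g along F is twice the symmetric part of ∇F
(`lie_chartMetric_apply`), hence at most 2L g. The proof never differentiates the flow in its
initial point. It uses Euler steps in a chart: locally they lengthen curves by a factor of at most 1
+ Ks for any K > L (`eventually_norm_chartSymmDeriv_euler_le`), and they differ from the flow by
o(s) (`eventually_dist_eulerStep_le`). So the distance of two nearby integral curves grows at rate
at most K (`exists_dist_sub_lt_mul`).

A Gronwall argument along a compact orbit segment turns this rate into a pointwise Lipschitz bound
for the flow. `lipschitzWith_of_eventually_edist_le` makes it global by following almost minimising
curves, so no minimising geodesics are needed. Finally K tends to L. -/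

noncomputable section
namespace RiemannianError

/-! ### Bilinear forms under an Euler step in a normed space -/

section EulerPullback

set_option synthInstance.maxHeartbeats 400000

variable {E : Type*} [NormedAddCommGroup E] [NormedSpace ℝ E]

/-- The pullback of the bilinear forms `G` under the Euler map `u ↦ u + s • f u`. -/
def eulerPullback (G : E → E →L[ℝ] E →L[ℝ] ℝ) (f : E → E) (p : ℝ × E) : E →L[ℝ] E →L[ℝ] ℝ :=
  (G (p.2 + p.1 • f p.2)).bilinearComp (.id ℝ E + p.1 • fderiv ℝ f p.2)
    (.id ℝ E + p.1 • fderiv ℝ f p.2)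

lemma eulerPullback_apply (G : E → E →L[ℝ] E →L[ℝ] ℝ) (f : E → E) (p : ℝ × E) (v w : E) :
    eulerPullback G f p v w = G (p.2 + p.1 • f p.2) (v + p.1 • fderiv ℝ f p.2 v)
      (w + p.1 • fderiv ℝ f p.2 w) := by
  simp [eulerPullback]

lemma contDiffAt_bilinearComp_self {D : Type*} [NormedAddCommGroup D] [NormedSpace ℝ D]
    {T : D → E →L[ℝ] E →L[ℝ] ℝ} {A : D → E →L[ℝ] E} {x : D} {n : ℕ∞ω}
    (hT : ContDiffAt ℝ n T x) (hA : ContDiffAt ℝ n A x) :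
    ContDiffAt ℝ n (fun p ↦ (T p).bilinearComp (A p) (A p)) x := by
  have h0 : ContDiff ℝ n fun S : E →L[ℝ] E ↦ (ContinuousLinearMap.compL ℝ E E ℝ).flip S :=
    ContinuousLinearMap.contDiff _
  have h1 : ContDiffAt ℝ n (fun p ↦ (ContinuousLinearMap.compL ℝ E E ℝ).flip (A p)) x :=
    h0.contDiffAt.comp x hA
  exact h1.clm_comp (hT.clm_comp hA)

/-- The pullback contains the derivative of `f`, which costs one order of smoothness. -/
lemma contDiffAt_eulerPullback {G : E → E →L[ℝ] E →L[ℝ] ℝ} {f : E → E} {u₀ : E}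
    (hG : ContDiffAt ℝ 1 G u₀) (hf : ContDiffAt ℝ 2 f u₀) :
    ContDiffAt ℝ 1 (eulerPullback G f) (0, u₀) := by
  have hf1 : ContDiffAt ℝ 1 (fun p : ℝ × E ↦ f p.2) (0, u₀) :=
    (hf.of_le one_le_two).comp (0, u₀) contDiffAt_snd
  have hf2 : ContDiffAt ℝ 1 (fun p : ℝ × E ↦ fderiv ℝ f p.2) (0, u₀) :=
    (hf.fderiv_right (m := 1) le_rfl).comp (0, u₀) contDiffAt_snd
  have hA : ContDiffAt ℝ 1 (fun p : ℝ × E ↦ ContinuousLinearMap.id ℝ E + p.1 • fderiv ℝ f p.2)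
      (0, u₀) := contDiffAt_const.add (contDiffAt_fst.smul hf2)
  have hG' : ContDiffAt ℝ 1 (fun p : ℝ × E ↦ G (p.2 + p.1 • f p.2)) (0, u₀) := by
    refine ContDiffAt.comp (g := G) (0, u₀) ?_ (contDiffAt_snd.add (contDiffAt_fst.smul hf1))
    simpa using hG
  exact contDiffAt_bilinearComp_self hG' hA

/-- A C¹ map is strictly differentiable, so the first-order expansion in the step size, with one
fixed derivative `B`, is uniform over base points near `u₀`. This uniformity lets one step size
serve all points of a curve. -/
lemma exists_hasDerivAt_eventually_norm_sub_le {W : Type*} [NormedAddCommGroup W]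
    [NormedSpace ℝ W] {P : ℝ × E → W} {u₀ : E} (hP : ContDiffAt ℝ 1 P (0, u₀)) :
    ∃ B, HasDerivAt (fun s : ℝ ↦ P (s, u₀)) B 0 ∧ ∀ ε > 0,
      ∀ᶠ p : ℝ × E in 𝓝 (0, u₀), ‖P p - P (0, p.2) - p.1 • B‖ ≤ ε * |p.1| := by
  have hP := hP.hasStrictFDerivAt one_ne_zero
  refine ⟨fderiv ℝ P (0, u₀) (1, 0), ?_, fun ε hε ↦ ?_⟩
  · exact hP.hasFDerivAt.comp_hasDerivAt (0 : ℝ)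
      ((hasDerivAt_id (0 : ℝ)).prodMk (hasDerivAt_const (0 : ℝ) u₀))
  · have h1 := hP.isLittleO.def hε
    have h2 : Tendsto (fun p : ℝ × E ↦ (p, ((0 : ℝ), p.2))) (𝓝 (0, u₀)) (𝓝 ((0, u₀), (0, u₀))) := by
      have : Continuous (fun p : ℝ × E ↦ (p, ((0 : ℝ), p.2))) := by fun_prop
      exact this.tendsto' _ _ rfl
    filter_upwards [h2.eventually h1] with p hp
    have e1 : p - (0, p.2) = p.1 • ((1 : ℝ), (0 : E)) := by
      ext <;> simp
    rw [e1, map_smul] at hp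
    refine hp.trans_eq ?_
    rw [norm_smul]
    simp [Prod.norm_def]

lemma eventually_norm_sub_le_of_continuousAt {X W : Type*} [TopologicalSpace X]
    [SeminormedAddCommGroup W] {g : X → W} {x : X} (hg : ContinuousAt g x) {ε : ℝ} (hε : 0 < ε) :
    ∀ᶠ y in 𝓝 x, ‖g y - g x‖ ≤ ε := by
  filter_upwards [hg.eventually (Metric.closedBall_mem_nhds (g x) hε)] with y hy
  rwa [← dist_eq_norm]

lemma abs_bilinear_apply_self_le (T : E →L[ℝ] E →L[ℝ] ℝ) {a : ℝ} (ha : ‖T‖ ≤ a) (v : E) :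
    |T v v| ≤ a * ‖v‖ ^ 2 := by
  refine (T.le_opNorm₂ v v).trans ?_
  rw [pow_two, ← mul_assoc]
  gcongr

/-- If the Lie derivative of the positive definite form `G` along `f` is at most `K • G` at `u₀`,
then close to `u₀` the Euler map of `f` with a small step `s` expands `G` by a factor of at most
`1 + K' * s`, for every `K' > K`. -/
lemma eventually_eulerPullback_le {G : E → E →L[ℝ] E →L[ℝ] ℝ} {f : E → E} {u₀ : E}
    (hG : ContDiffAt ℝ 1 G u₀) (hf : ContDiffAt ℝ 2 f u₀) {c : ℝ} (hc : 0 < c)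
    (hpos : ∀ v, c * ‖v‖ ^ 2 ≤ G u₀ v v) {K : ℝ} (hK : 0 ≤ K)
    (hL : ∀ v, fderiv ℝ G u₀ (f u₀) v v + G u₀ (fderiv ℝ f u₀ v) v + G u₀ v (fderiv ℝ f u₀ v) ≤
      K * G u₀ v v) {K' : ℝ} (hK' : K < K') :
    ∀ᶠ p : ℝ × E in 𝓝 (0, u₀), 0 ≤ p.1 → ∀ v,
      G (p.2 + p.1 • f p.2) (v + p.1 • fderiv ℝ f p.2 v) (v + p.1 • fderiv ℝ f p.2 v) ≤
        (1 + K' * p.1) * G p.2 v v := by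
  obtain ⟨B, h1, hs⟩ :=
    exists_hasDerivAt_eventually_norm_sub_le (contDiffAt_eulerPullback hG hf)
  set P := eulerPullback G f with hPdef
  -- The derivative of the pullback at step size 0 is the Lie derivative of `G` along `f`, by the
  -- product rule.
  have hBv (v : E) : B v v ≤ K * G u₀ v v := by
    refine le_of_eq_of_le ?_ (hL v)
    have h2 : HasDerivAt (fun s : ℝ ↦ P (s, u₀) v v) (B v v) 0 := by
      simpa using (h1.clm_apply (hasDerivAt_const _ v)).clm_apply (hasDerivAt_const _ v)
    have h3 (a b : E) : HasDerivAt (fun s : ℝ ↦ a + s • b) b 0 := by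
      simpa using ((hasDerivAt_id (0 : ℝ)).smul_const b).const_add a
    have h4 : HasDerivAt (fun s : ℝ ↦ G (u₀ + s • f u₀)) (fderiv ℝ G u₀ (f u₀)) 0 := by
      refine HasFDerivAt.comp_hasDerivAt (l := G) (0 : ℝ) ?_ (h3 u₀ (f u₀))
      simpa using (hG.differentiableAt one_ne_zero).hasFDerivAt
    have h5 := (h4.clm_apply (h3 v (fderiv ℝ f u₀ v))).clm_apply (h3 v (fderiv ℝ f u₀ v))
    have h6 : (fun s : ℝ ↦ P (s, u₀) v v) = fun s : ℝ ↦ G (u₀ + s • f u₀)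
        (v + s • fderiv ℝ f u₀ v) (v + s • fderiv ℝ f u₀ v) := by
      ext s; simp [hPdef, eulerPullback_apply]
    rw [h6] at h2
    simpa using h2.unique h5
  -- The bound `c / 2` keeps `G` coercive near `u₀`. The second bound lets the gap `K' - K` absorb
  -- one `ε` from the expansion in the step size and `K * ε` from replacing `G u₀` by `G p.2`.
  obtain ⟨ε, hε, hεc, hεK⟩ : ∃ ε > 0, ε ≤ c / 2 ∧ (1 + K) * ε ≤ (K' - K) * (c / 2) := by
    refine ⟨min (c / 2) ((K' - K) * (c / 2) / (1 + K)), ?_, min_le_left _ _, ?_⟩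
    · have := sub_pos.2 hK'
      positivity
    · calc (1 + K) * min (c / 2) ((K' - K) * (c / 2) / (1 + K))
          ≤ (1 + K) * ((K' - K) * (c / 2) / (1 + K)) := by gcongr; exact min_le_right _ _
        _ = _ := by field_simp
  have hc' : ∀ᶠ p : ℝ × E in 𝓝 (0, u₀), ‖G p.2 - G u₀‖ ≤ ε :=
    (continuous_snd.tendsto' ((0 : ℝ), u₀) u₀ rfl).eventually
      (eventually_norm_sub_le_of_continuousAt (W := E →L[ℝ] E →L[ℝ] ℝ) hG.continuousAt hε)
  filter_upwards [hs ε hε, hc'] with p h1 h2 h0 v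
  have h3 := abs_le.1 (abs_bilinear_apply_self_le _ h1 v)
  have h4 := abs_le.1 (abs_bilinear_apply_self_le _ h2 v)
  have h5 : P p v v = G (p.2 + p.1 • f p.2) (v + p.1 • fderiv ℝ f p.2 v)
      (v + p.1 • fderiv ℝ f p.2 v) := eulerPullback_apply ..
  have h6 : P (0, p.2) v v = G p.2 v v := by simp [hPdef, eulerPullback_apply]
  rw [← h5]
  simp only [sub_apply, smul_apply, h6, abs_of_nonneg h0, smul_eq_mul] at h3 h4
  have h7 := hBv v
  have h8 := hpos v
  have h9 : c / 2 * ‖v‖ ^ 2 ≤ G p.2 v v := by nlinarith [sq_nonneg ‖v‖]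
  have h10 : B v v + ε * ‖v‖ ^ 2 ≤ K' * G p.2 v v := by
    have : K * G u₀ v v ≤ K * (G p.2 v v + ε * ‖v‖ ^ 2) := by gcongr; linarith
    have h11 : (1 + K) * ε * ‖v‖ ^ 2 ≤ (K' - K) * (c / 2) * ‖v‖ ^ 2 := by gcongr
    have h12 : (K' - K) * (c / 2 * ‖v‖ ^ 2) ≤ (K' - K) * G p.2 v v :=
      mul_le_mul_of_nonneg_left h9 (sub_pos.2 hK').le
    linarith
  have := mul_le_mul_of_nonneg_left h10 h0
  linarith

end EulerPullback

/-! ### Distance and length of curves -/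

section LengthSpace

open scoped NNReal ENNReal

variable {E : Type*} [NormedAddCommGroup E] [NormedSpace ℝ E]
  {H : Type*} [TopologicalSpace H] {I : ModelWithCorners ℝ E H}
  {M : Type*} [PseudoMetricSpace M] [ChartedSpace H M]
  [RiemannianBundle (fun x : M ↦ TangentSpace I x)] [IsRiemannianManifold I M]

lemma edist_le_pathELength {γ : ℝ → M} {a b : ℝ} (hγ : ContMDiffOn 𝓘(ℝ, ℝ) I 1 γ (Icc a b))
    (hab : a ≤ b) : edist (γ a) (γ b) ≤ pathELength I γ a b := by
  rw [IsRiemannianManifold.out (I := I) (γ a) (γ b)]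
  exact riemannianEDist_le_pathELength hγ rfl rfl hab

end LengthSpace

/-! ### From pointwise to global Lipschitz bounds -/

section PointwiseLipschitz

open scoped NNReal ENNReal

/-- On a Riemannian manifold, a map which is pointwise Lipschitz with a uniform constant is
Lipschitz with this constant. -/
theorem lipschitzWith_of_eventually_edist_le {E : Type*} [NormedAddCommGroup E] [NormedSpace ℝ E]
    {H : Type*} [TopologicalSpace H] (I : ModelWithCorners ℝ E H)
    {M : Type*} [PseudoMetricSpace M] [ChartedSpace H M]
    [RiemannianBundle (fun x : M ↦ TangentSpace I x)] [IsRiemannianManifold I M]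
    {N : Type*} [PseudoEMetricSpace N] {f : M → N} {Λ : ℝ≥0}
    (h : ∀ x, ∀ᶠ y in 𝓝 x, edist (f x) (f y) ≤ Λ * edist x y) : LipschitzWith Λ f := by
  have hf : Continuous f := by
    refine continuous_iff_continuousAt.2 fun x ↦ ?_
    rw [ContinuousAt, tendsto_iff_edist_tendsto_0]
    have h1 : Tendsto (fun y ↦ Λ * edist x y) (𝓝 x) (𝓝 0) := by
      have : Continuous fun y ↦ Λ * edist x y :=
        ENNReal.continuous_const_mul ENNReal.coe_ne_top |>.comp (continuous_const.edist continuous_id)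
      exact this.tendsto' _ _ (by simp)
    refine tendsto_of_tendsto_of_tendsto_of_le_of_le' tendsto_const_nhds h1
      (Eventually.of_forall fun _ ↦ zero_le) ?_
    filter_upwards [h x] with y hy
    rwa [edist_comm]
  intro x y
  have key : ∀ r > edist x y, edist (f x) (f y) ≤ Λ * r := by
    intro r hr
    rw [gt_iff_lt, IsRiemannianManifold.out (I := I) x y] at hr
    obtain ⟨γ, rfl, rfl, hγ, hlen, -⟩ :=
      exists_lt_locally_constant_of_riemannianEDist_lt hr zero_lt_one
    set P : ℝ → Prop := fun s ↦ edist (f (γ 0)) (f (γ s)) ≤ Λ * pathELength I γ 0 s with hP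
    have hfγ : Continuous fun s ↦ edist (f (γ 0)) (f (γ s)) :=
      continuous_const.edist (hf.comp hγ.continuous)
    have hP0 : P 0 := by simp [hP]
    -- Continuous induction on time. Since `A` is downward closed, its closedness needs only
    -- continuity of `f ∘ γ` and monotonicity of the length, not continuity of the length in its
    -- endpoint.
    let A : Set ℝ := {t | ∀ s ∈ Icc 0 t, P s}
    have hA : IsClosed A := by
      refine isClosed_of_closure_subset fun t ht s hs ↦ ?_
      rcases hs.2.lt_or_eq with hst | rfl
      · obtain ⟨a, ha, haA⟩ := mem_closure_iff.1 ht (Ioi s) isOpen_Ioi hst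
        exact haA s ⟨hs.1, ha.le⟩
      rcases hs.1.eq_or_lt with rfl | hs0
      · exact hP0
      by_contra hns
      have hU : IsOpen {a | Λ * pathELength I γ 0 s < edist (f (γ 0)) (f (γ a))} :=
        isOpen_lt continuous_const hfγ
      obtain ⟨a, ha, haA⟩ := mem_closure_iff.1 ht _ (hU.inter isOpen_Ioi)
        ⟨not_le.1 hns, hs0⟩
      rcases le_or_gt s a with hsa | has
      · exact hns (haA s ⟨hs.1, hsa⟩)
      · refine absurd ((haA a ⟨(mem_Ioi.1 ha.2).le, le_rfl⟩).trans ?_) (not_le.2 ha.1)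
        gcongr
    have hsub : Icc 0 1 ⊆ A := by
      refine (hA.inter isClosed_Icc).Icc_subset_of_forall_mem_nhdsGT_of_Icc_subset ?_ ?_
      · intro s hs
        rw [Icc_self, mem_singleton_iff] at hs
        rwa [hs]
      · intro t ht htA
        -- The pointwise bound at `γ t` extends `P` a little to the right, because length is
        -- additive along `γ`.
        have h1 : ∀ᶠ s in 𝓝[>] t, edist (f (γ t)) (f (γ s)) ≤ Λ * edist (γ t) (γ s) :=
          (hγ.continuous.tendsto t).eventually (h (γ t)) |>.filter_mono nhdsWithin_le_nhds
        obtain ⟨u, hu, hus⟩ := mem_nhdsGT_iff_exists_Ioo_subset.1 h1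
        filter_upwards [Ioo_mem_nhdsGT hu] with s hs s' hs'
        rcases le_or_gt s' t with hst | hst
        · exact htA ⟨hs'.1, hst⟩ s' ⟨hs'.1, le_rfl⟩
        · have h2 : P t := htA ⟨ht.1, le_rfl⟩ t ⟨ht.1, le_rfl⟩
          have h3 := hus ⟨hst, hs'.2.trans_lt hs.2⟩
          calc edist (f (γ 0)) (f (γ s'))
              ≤ edist (f (γ 0)) (f (γ t)) + edist (f (γ t)) (f (γ s')) := edist_triangle _ _ _
            _ ≤ Λ * pathELength I γ 0 t + Λ * pathELength I γ t s' := by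
                refine add_le_add h2 (le_trans h3 ?_)
                gcongr
                exact edist_le_pathELength hγ.contMDiffOn hst.le
            _ = Λ * pathELength I γ 0 s' := by
                rw [← mul_add, pathELength_add ht.1 hst.le]
    have h4 : P 1 := hsub ⟨zero_le_one, le_rfl⟩ 1 ⟨zero_le_one, le_rfl⟩
    exact h4.trans (by gcongr)
  have hlim : Tendsto (fun r : ℝ≥0∞ ↦ Λ * r) (𝓝[>] (edist x y)) (𝓝 (Λ * edist x y)) :=
    ((ENNReal.continuous_const_mul ENNReal.coe_ne_top).tendsto _).mono_left nhdsWithin_le_nhds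
  have := nhdsGT_neBot_of_exists_gt ⟨⊤, edist_lt_top x y⟩
  exact ge_of_tendsto hlim (eventually_mem_nhdsWithin.mono fun r hr ↦ key r hr)

end PointwiseLipschitz

/-! ### A Gronwall inequality below a threshold -/

section Gronwall

/-- A quantity growing at rate at most `K` as long as it is smaller than `δ` stays below its
exponential bound if this bound is smaller than `δ`. -/
lemma le_mul_exp_of_frequently_slope_lt {d : ℝ → ℝ} {T K δ : ℝ} (hT : 0 ≤ T) (hK : 0 ≤ K)
    (hd : Continuous d) (hd0 : ∀ t, 0 ≤ d t)
    (hs : ∀ t ∈ Ico 0 T, d t < δ → ∀ r, K * d t < r →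
      ∀ᶠ s in 𝓝[>] (0 : ℝ), d (t + s) - d t < r * s)
    (h0 : d 0 * Real.exp (K * T) < δ) : ∀ t ∈ Icc 0 T, d t ≤ d 0 * Real.exp (K * t) := by
  have hδ : 0 ≤ δ := (mul_nonneg (hd0 0) (Real.exp_pos _).le).trans h0.le
  have h1 : d 0 < δ := by
    refine lt_of_le_of_lt (le_mul_of_one_le_right (hd0 0) ?_) h0
    exact Real.one_le_exp (mul_nonneg hK hT)
  -- Truncation makes the growth bound hold at all times: where `d` reaches `δ`, the function `g` is
  -- at its maximum and its right slopes are nonpositive. As the Gronwall bound for `g` stays below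
  -- `δ`, it is a bound for `d`.
  set g : ℝ → ℝ := fun t ↦ min (d t) δ with hg
  have key : ∀ t ∈ Icc 0 T, g t ≤ gronwallBound (d 0) K 0 (t - 0) := by
    refine le_gronwallBound_of_liminf_deriv_right_le (f' := fun t ↦ K * g t)
      (hd.min continuous_const).continuousOn ?_ (min_le_left _ _) (fun t _ ↦ by simp)
    intro t ht r hr
    refine Eventually.frequently ?_
    by_cases hdt : d t < δ
    · have hgt : g t = d t := min_eq_left hdt.le
      have h2 := hs t ht hdt r (by simpa only [hgt] using hr)
      have h3 : Tendsto (fun z ↦ z - t) (𝓝[>] t) (𝓝[>] 0) := by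
        refine tendsto_nhdsWithin_iff.2 ⟨?_, ?_⟩
        · exact ((continuous_id.sub continuous_const).tendsto' t 0 (by simp)).mono_left
            nhdsWithin_le_nhds
        · filter_upwards [self_mem_nhdsWithin] with z hz using sub_pos.2 (mem_Ioi.1 hz)
      filter_upwards [h3.eventually h2, self_mem_nhdsWithin] with z hz hzt
      have hzt' : 0 < z - t := sub_pos.2 hzt
      rw [inv_mul_lt_iff₀ hzt', mul_comm, hgt]
      rw [add_sub_cancel] at hz
      exact lt_of_le_of_lt (sub_le_sub_right (min_le_left _ _) _) hz
    · have hgt : g t = δ := min_eq_right (not_lt.1 hdt)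
      have hr0 : 0 < r := lt_of_le_of_lt (mul_nonneg hK (le_min (hd0 t) hδ)) hr
      filter_upwards [self_mem_nhdsWithin] with z hz
      refine lt_of_le_of_lt (mul_nonpos_of_nonneg_of_nonpos ?_ ?_) hr0
      · exact inv_nonneg.2 (sub_nonneg.2 (mem_Ioi.1 hz).le)
      · rw [hgt]
        exact sub_nonpos.2 (min_le_right _ _)
  intro t ht
  have h2 := key t ht
  rw [gronwallBound_ε0, sub_zero] at h2
  have h3 : d 0 * Real.exp (K * t) < δ := by
    refine lt_of_le_of_lt ?_ h0
    have := hd0 0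
    gcongr
    exact ht.2
  rcases min_le_iff.1 h2 with h4 | h4
  · exact h4
  · exact absurd h4 (not_le.2 h3)

end Gronwall

/-! ### The recursion for the global error -/

section ErrorRecursion

/-- The right-hand side solves the recursion exactly with the source term C/L (exp(Lh) - 1) h^p, and
this dominates C h^{p+1} because Lh ≤ exp(Lh) - 1. -/
lemma le_of_forall_succ_le_exp_mul_add {e : ℕ → ℝ} {C L h : ℝ} {p : ℕ} (hC : 0 ≤ C) (hL : 0 < L)
    (hh : 0 < h) (h0 : e 0 = 0)
    (hs : ∀ k, e (k + 1) ≤ Real.exp (L * h) * e k + C * h ^ (p + 1)) (k : ℕ) :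
    e k ≤ C / L * (Real.exp (k * h * L) - 1) * h ^ p := by
  induction k with
  | zero => simp [h0]
  | succ k ih =>
    have h1 : Real.exp ((k + 1 : ℕ) * h * L) = Real.exp (L * h) * Real.exp (k * h * L) := by
      rw [← Real.exp_add]; congr 1; push_cast; ring
    have h2 : L * h ≤ Real.exp (L * h) - 1 := by linarith [Real.add_one_le_exp (L * h)]
    have h3 : C * h ^ (p + 1) ≤ C / L * (Real.exp (L * h) - 1) * h ^ p := by
      calc C * h ^ (p + 1) = C / L * (L * h) * h ^ p := by field_simp; ring
        _ ≤ _ := by gcongr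
    calc e (k + 1) ≤ Real.exp (L * h) * e k + C * h ^ (p + 1) := hs k
      _ ≤ Real.exp (L * h) * (C / L * (Real.exp (k * h * L) - 1) * h ^ p) +
          C / L * (Real.exp (L * h) - 1) * h ^ p := by gcongr
      _ = _ := by rw [h1]; ring

end ErrorRecursion

/-! ### Vector fields in a chart -/

section Chart

variable {E : Type*} [NormedAddCommGroup E] [NormedSpace ℝ E]
  {H : Type*} [TopologicalSpace H] {I : ModelWithCorners ℝ E H}
  {M : Type*} [TopologicalSpace M] [ChartedSpace H M]

variable (I) in
/-- The derivative of the inverse of the preferred chart at `z`. -/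
def chartSymmDeriv (z : M) (u : E) : E →L[ℝ] TangentSpace I ((extChartAt I z).symm u) :=
  mfderiv 𝓘(ℝ, E) I (extChartAt I z).symm u

/-- The representation of a vector field in the preferred chart at `z`. -/
def chartField (z : M) (F : Π x : M, TangentSpace I x) : E → E :=
  VectorField.mpullbackWithin 𝓘(ℝ, E) I (extChartAt I z).symm F (range I)

variable [IsManifold I ∞ M]

variable (I) in
/-- The local vector field which is constantly `v` in the preferred chart at `z`. -/
def chartConstField (z : M) (v : E) (x : M) : TangentSpace I x :=
  (trivializationAt E (TangentSpace I) z).symm x v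

variable [I.Boundaryless]

lemma hasMFDerivAt_chart_symm {z : M} {u : E} (hu : u ∈ (extChartAt I z).target) :
    HasMFDerivAt 𝓘(ℝ, E) I (extChartAt I z).symm u (chartSymmDeriv I z u) := by
  have h := mdifferentiableWithinAt_extChartAt_symm hu
  rw [I.range_eq_univ, mdifferentiableWithinAt_univ] at h
  exact h.hasMFDerivAt

lemma chartSymmDeriv_eq (z : M) (u : E) :
    chartSymmDeriv I z u = mfderivWithin 𝓘(ℝ, E) I (extChartAt I z).symm (range I) u := by
  rw [I.range_eq_univ, mfderivWithin_univ, chartSymmDeriv]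

lemma isInvertible_chartSymmDeriv {z : M} {u : E} (hu : u ∈ (extChartAt I z).target) :
    (chartSymmDeriv I z u).IsInvertible := by
  rw [chartSymmDeriv_eq]
  exact isInvertible_mfderivWithin_extChartAt_symm hu

lemma chartSymmDeriv_chartField {z : M} {u : E} (hu : u ∈ (extChartAt I z).target)
    (F : Π x : M, TangentSpace I x) :
    chartSymmDeriv I z u (chartField z F u) = F ((extChartAt I z).symm u) := by
  have h := isInvertible_chartSymmDeriv hu
  rw [chartField, VectorField.mpullbackWithin_apply, ← chartSymmDeriv_eq]
  exact h.self_apply_inverse _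

lemma chartConstField_symm_apply {z : M} {u : E} (hu : u ∈ (extChartAt I z).target) (v : E) :
    chartConstField I z v ((extChartAt I z).symm u) = chartSymmDeriv I z u v := by
  have hx : (extChartAt I z).symm u ∈ (chartAt H z).source := by
    simpa using (extChartAt I z).map_target hu
  have h := TangentBundle.symmL_trivializationAt (I := I) hx
  have h' := congr($h v)
  rw [chartSymmDeriv_eq]
  rw [Trivialization.symmL_apply _ (by simpa using hx)] at h'
  refine h'.trans ?_
  rw [(extChartAt I z).right_inv hu]
  rfl

lemma contMDiffAt_chartConstField {z x : M} (hx : x ∈ (chartAt H z).source) (v : E) :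
    ContMDiffAt I (I.prod 𝓘(ℝ, E)) ∞ (T% (chartConstField I z v)) x := by
  set e := trivializationAt E (TangentSpace I) z
  have hxe : x ∈ e.baseSet := by simpa [e] using hx
  rw [e.contMDiffAt_section_iff hxe]
  refine (contMDiffAt_const (c := v)).congr_of_eventuallyEq ?_
  filter_upwards [e.open_baseSet.mem_nhds hxe] with y hy
  simp only [chartConstField]
  rw [e.apply_mk_symm hy]

lemma contDiffAt_chartField [CompleteSpace E] (z : M) {F : Π x : M, TangentSpace I x}
    (hF : ContMDiffAt I I.tangent ∞ (T% F) z) :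
    ContDiffAt ℝ ∞ (chartField z F) (extChartAt I z z) := by
  have h := VectorField.contMDiffWithinAt_mpullbackWithin_extChartAt_symm (n := ∞)
    (m := ∞) (s := univ) hF.contMDiffWithinAt uniqueMDiffOn_univ (mem_univ z) le_rfl
  rw [contMDiffWithinAt_vectorSpace_iff_contDiffWithinAt] at h
  refine h.contDiffAt ?_
  simpa using extChartAt_target_mem_nhds z

end Chart

/-! ### The metric and its Lie derivative in a chart -/

section ChartMetric

variable {E : Type*} [NormedAddCommGroup E] [NormedSpace ℝ E]
  {H : Type*} [TopologicalSpace H] {I : ModelWithCorners ℝ E H}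
  {M : Type*} [TopologicalSpace M] [ChartedSpace H M]
  [RiemannianBundle (fun x : M ↦ TangentSpace I x)]

variable (I) in
/-- The Riemannian metric in the preferred chart at `z`. -/
def chartMetric (z : M) (u : E) : E →L[ℝ] E →L[ℝ] ℝ :=
  (innerSL ℝ (E := TangentSpace I ((extChartAt I z).symm u))).bilinearComp
    (chartSymmDeriv I z u) (chartSymmDeriv I z u)

lemma chartMetric_apply (z : M) (u v w : E) : chartMetric I z u v w =
    inner ℝ (chartSymmDeriv I z u v) (chartSymmDeriv I z u w) := by
  rfl

variable [IsManifold I ∞ M] [I.Boundaryless]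

lemma chartMetric_eq {z : M} {u : E} (hu : u ∈ (extChartAt I z).target) (v w : E) :
    chartMetric I z u v w = inner ℝ (chartConstField I z v ((extChartAt I z).symm u))
      (chartConstField I z w ((extChartAt I z).symm u)) := by
  rw [chartMetric_apply, chartConstField_symm_apply hu, chartConstField_symm_apply hu]

variable [FiniteDimensional ℝ E]
  [IsContMDiffRiemannianBundle I ∞ E (fun x : M ↦ TangentSpace I x)]

lemma contMDiffAt_inner {X Y : Π x : M, TangentSpace I x} {x : M}
    (hX : ContMDiffAt I (I.prod 𝓘(ℝ, E)) ∞ (T% X) x)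
    (hY : ContMDiffAt I (I.prod 𝓘(ℝ, E)) ∞ (T% Y) x) :
    ContMDiffAt I 𝓘(ℝ, ℝ) ∞ (fun y ↦ inner ℝ (X y) (Y y)) x :=
  ContMDiffAt.inner_bundle (IB := I) (F := E) (E := fun x : M ↦ TangentSpace I x) (b := id)
    (v := X) (w := Y) hX hY

/-- In finite dimension it suffices to test on fixed vectors `v` and `w`; the resulting entries are
inner products of the smooth chart-constant fields. -/
lemma contDiffOn_chartMetric (z : M) :
    ContDiffOn ℝ ∞ (chartMetric I z) (extChartAt I z).target := by
  rw [contDiffOn_clm_apply]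
  intro v
  rw [contDiffOn_clm_apply]
  intro w
  rw [← contMDiffOn_iff_contDiffOn]
  have h1 : ContMDiffOn I 𝓘(ℝ, ℝ) ∞
      (fun x ↦ inner ℝ (chartConstField I z v x) (chartConstField I z w x))
      (extChartAt I z).source := fun x hx ↦ by
    have hx' : x ∈ (chartAt H z).source := by simpa using hx
    exact (contMDiffAt_inner (contMDiffAt_chartConstField hx' v)
      (contMDiffAt_chartConstField hx' w)).contMDiffWithinAt
  exact (h1.comp (contMDiffOn_extChartAt_symm z) (extChartAt I z).mapsTo_symm).congr
    fun u hu ↦ chartMetric_eq hu v w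

lemma contDiffAt_chartMetric (z : M) :
    ContDiffAt ℝ ∞ (chartMetric I z) (extChartAt I z z) :=
  (contDiffOn_chartMetric z).contDiffAt (extChartAt_target_mem_nhds z)

lemma chartField_chartConstField {z : M} {u : E} (hu : u ∈ (extChartAt I z).target) (v : E) :
    chartField z (chartConstField I z v) u = v := by
  rw [chartField, VectorField.mpullbackWithin_apply, ← chartSymmDeriv_eq,
    chartConstField_symm_apply hu]
  exact (isInvertible_chartSymmDeriv hu).inverse_apply_self _

lemma inverse_mfderiv_extChartAt {z : M} {u : E} (hu : u ∈ (extChartAt I z).target) :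
    (mfderiv I 𝓘(ℝ, E) (extChartAt I z) ((extChartAt I z).symm u)).inverse =
      chartSymmDeriv I z u := by
  refine ContinuousLinearMap.inverse_eq ?_ ?_
  · rw [chartSymmDeriv_eq]
    exact mfderiv_extChartAt_comp_mfderivWithin_extChartAt_symm hu
  · rw [chartSymmDeriv_eq]
    exact mfderivWithin_extChartAt_symm_comp_mfderiv_extChartAt hu

/-- In the chart the first field is constant, so only the derivative of `F` survives in the bracket.
-/
lemma mlieBracket_chartConstField (z : M) (v : E) (F : Π x : M, TangentSpace I x) :
    VectorField.mlieBracket I (chartConstField I z v) F ((extChartAt I z).symm (extChartAt I z z)) =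
      chartSymmDeriv I z (extChartAt I z z)
        (fderiv ℝ (chartField z F) (extChartAt I z z) v) := by
  have hz := mem_extChartAt_target (I := I) z
  -- The base point equals `z` only propositionally, and the tangent space depends on it; a general
  -- `x` allows substitution.
  have h1 (x : M) (hx : x = z) : VectorField.mlieBracket I (chartConstField I z v) F x =
      (mfderiv I 𝓘(ℝ, E) (extChartAt I z) x).inverse (VectorField.lieBracketWithin ℝ (E := E)
        (chartField z (chartConstField I z v)) (chartField z F)
        ((extChartAt I z).symm ⁻¹' univ ∩ range I) (extChartAt I z z)) := by
    subst hx
    rfl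
  have h2 : chartField z (chartConstField I z v) =ᶠ[𝓝 (extChartAt I z z)] fun _ ↦ v := by
    filter_upwards [extChartAt_target_mem_nhds z] with u hu using chartField_chartConstField hu v
  have h3 : VectorField.lieBracketWithin ℝ (E := E) (chartField z (chartConstField I z v))
      (chartField z F) ((extChartAt I z).symm ⁻¹' univ ∩ range I) (extChartAt I z z) =
        fderiv ℝ (chartField z F) (extChartAt I z z) v := by
    rw [I.range_eq_univ, preimage_univ, inter_univ, VectorField.lieBracketWithin_univ,
      VectorField.lieBracket, h2.fderiv_eq, h2.eq_of_nhds]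
    simp
  rw [h1 _ (extChartAt_to_inv z), inverse_mfderiv_extChartAt hz]
  exact congrArg (chartSymmDeriv I z (extChartAt I z z)) h3

lemma fderiv_chartMetric_apply (z : M) (v w : E) (F : Π x : M, TangentSpace I x) :
    fderiv ℝ (chartMetric I z) (extChartAt I z z) (chartField z F (extChartAt I z z)) v w =
      d% (fun y ↦ inner ℝ (chartConstField I z v y) (chartConstField I z w y))
        ((extChartAt I z).symm (extChartAt I z z)) (F ((extChartAt I z).symm (extChartAt I z z))) := by
  have hz := mem_extChartAt_target (I := I) z
  set u := extChartAt I z z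
  have hx : (extChartAt I z).symm u ∈ (chartAt H z).source := by
    simp [u]
  have h1 : MDiffAt (fun y ↦ inner ℝ (chartConstField I z v y) (chartConstField I z w y))
      ((extChartAt I z).symm u) :=
    mdiff_inner ((contMDiffAt_chartConstField hx v).mdifferentiableAt (by simp))
      ((contMDiffAt_chartConstField hx w).mdifferentiableAt (by simp))
  have h2 := h1.hasMFDerivAt.comp u (hasMFDerivAt_chart_symm hz)
  set g := fun y ↦ inner ℝ (chartConstField I z v y) (chartConstField I z w y) with hg
  have h3 : HasFDerivAt (fun u ↦ chartMetric I z u v w)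
      ((d% g ((extChartAt I z).symm u)).comp (chartSymmDeriv I z u)) u := by
    have h2' : HasFDerivAt (g ∘ (extChartAt I z).symm)
      ((d% g ((extChartAt I z).symm u)).comp (chartSymmDeriv I z u)) u := h2.hasFDerivAt
    refine h2'.congr_of_eventuallyEq ?_
    filter_upwards [extChartAt_target_mem_nhds z] with u hu using chartMetric_eq hu v w
  have h4 : HasFDerivAt (fun u ↦ chartMetric I z u v w) _ u :=
    ((((contDiffAt_chartMetric z).differentiableAt (by simp)).hasFDerivAt.clm_apply
      (hasFDerivAt_const v u)).clm_apply (hasFDerivAt_const w u))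
  have h5 := congr($(h4.unique h3) (chartField z F u))
  have h6 := chartSymmDeriv_chartField hz F
  rw [← h6]
  refine Eq.trans ?_ h5
  simp [u]

/-- The Lie derivative of the metric along `F`, computed in a chart, is twice the symmetric part
of `∇ F`. -/
lemma lie_chartMetric_apply (z : M) (v : E) {F : Π x : M, TangentSpace I x}
    (hF : ContMDiffAt I I.tangent ∞ (T% F) z) :
    fderiv ℝ (chartMetric I z) (extChartAt I z z) (chartField z F (extChartAt I z z)) v v
      + chartMetric I z (extChartAt I z z)
          (fderiv ℝ (chartField z F) (extChartAt I z z) v) v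
      + chartMetric I z (extChartAt I z z) v
          (fderiv ℝ (chartField z F) (extChartAt I z z) v) =
    2 * inner ℝ (leviCivita I M F ((extChartAt I z).symm (extChartAt I z z))
        (chartSymmDeriv I z (extChartAt I z z) v)) (chartSymmDeriv I z (extChartAt I z z) v) := by
  have hz := mem_extChartAt_target (I := I) z
  have hx : (extChartAt I z).symm (extChartAt I z z) ∈ (chartAt H z).source := by
    simp
  have hV : MDiffAt (T% (chartConstField I z v)) ((extChartAt I z).symm (extChartAt I z z)) :=
    (contMDiffAt_chartConstField hx v).mdifferentiableAt (by simp)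
  have hF' : MDiffAt (T% F) ((extChartAt I z).symm (extChartAt I z z)) := by
    rw [extChartAt_to_inv]
    exact hF.mdifferentiableAt (by simp)
  -- Koszul's formula with X = Z = V and Y = F: the terms V g(F, V) and V g(V, F) cancel, [V, V] =
  -- 0, and the other two brackets agree. What remains is F g(V, V) + 2 g([V, F], V), the Lie
  -- derivative.
  have h1 := inner_leviCivitaFun hV hF' hV
  rw [chartConstField_symm_apply hz] at h1
  refine Eq.trans ?_ h1.symm
  have h2 : (fun y ↦ inner ℝ (F y) (chartConstField I z v y)) =
      fun y ↦ inner ℝ (chartConstField I z v y) (F y) := by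
    ext y; exact real_inner_comm _ _
  have h3 : inner ℝ (VectorField.mlieBracket I (chartConstField I z v) (chartConstField I z v)
      ((extChartAt I z).symm (extChartAt I z z)))
      (F ((extChartAt I z).symm (extChartAt I z z))) = 0 := by
    rw [VectorField.mlieBracket_self]
    exact inner_zero_left _
  rw [koszul, fderiv_chartMetric_apply, h2, h3,
    VectorField.mlieBracket_swap_apply (V := F), mlieBracket_chartConstField,
    chartConstField_symm_apply hz, chartMetric_apply, chartMetric_apply, inner_neg_left,
    real_inner_comm (chartSymmDeriv I z (extChartAt I z z) v)]
  ring

end ChartMetric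

/-! ### Comparing distances and integral curves with the chart -/

section ChartEstimates

open scoped NNReal ENNReal
open MeasureTheory

variable {E : Type*} [NormedAddCommGroup E] [NormedSpace ℝ E]
  {H : Type*} [TopologicalSpace H] {I : ModelWithCorners ℝ E H} [I.Boundaryless]
  {M : Type*} [PseudoMetricSpace M] [ChartedSpace H M] [IsManifold I ∞ M]

lemma mfderiv_extChartAt_eq_chartField {z x : M} (hx : x ∈ (extChartAt I z).source)
    (F : Π x : M, TangentSpace I x) :
    mfderiv I 𝓘(ℝ, E) (extChartAt I z) x (F x) = chartField z F (extChartAt I z x) := by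
  obtain ⟨u, hu, rfl⟩ : ∃ u ∈ (extChartAt I z).target, (extChartAt I z).symm u = x :=
    ⟨_, (extChartAt I z).map_source hx, (extChartAt I z).left_inv hx⟩
  set w : E := chartField z F u with hw
  have h := mfderiv_extChartAt_comp_mfderivWithin_extChartAt_symm (I := I) hu
  rw [← chartSymmDeriv_eq] at h
  refine Eq.trans ?_ (congrArg (chartField z F) ((extChartAt I z).right_inv hu).symm)
  exact (congrArg (mfderiv I 𝓘(ℝ, E) (extChartAt I z) ((extChartAt I z).symm u))
    (chartSymmDeriv_chartField hu F).symm).trans (DFunLike.congr_fun h w)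

lemma hasDerivAt_extChartAt_comp {z : M} {F : Π x : M, TangentSpace I x} {γ : ℝ → M}
    (hγ : IsMIntegralCurve γ F) {t : ℝ} (ht : γ t ∈ (extChartAt I z).source) :
    HasDerivAt (extChartAt I z ∘ γ) (chartField z F (extChartAt I z (γ t))) t := by
  have h1 : HasMFDerivAt I 𝓘(ℝ, E) (extChartAt I z) (γ t) _ :=
    (mdifferentiableAt_extChartAt (by simpa using ht)).hasMFDerivAt
  obtain ⟨T, hT, h2⟩ : ∃ T : ℝ →L[ℝ] E, T 1 = chartField z F (extChartAt I z (γ t)) ∧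
      HasFDerivAt (extChartAt I z ∘ γ) T t := by
    refine ⟨_, ?_, (h1.comp t (hγ t)).hasFDerivAt⟩
    rw [← mfderiv_extChartAt_eq_chartField ht]
    exact congrArg (mfderiv I 𝓘(ℝ, E) (extChartAt I z) (γ t)) (one_smul ℝ (F (γ t)))
  exact hT ▸ h2.hasDerivAt

/-- The Euler step of size `s` for the vector field `F`, in the preferred chart at `z`. -/
def eulerStep (z : M) (F : Π x : M, TangentSpace I x) (s : ℝ) (x : M) : M :=
  (extChartAt I z).symm (extChartAt I z x + s • chartField z F (extChartAt I z x))

variable [RiemannianBundle (fun x : M ↦ TangentSpace I x)]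

lemma pathELength_extChartAt_symm_comp {z : M} {c : ℝ → E} (hc : ContDiffOn ℝ 1 c (Icc 0 1))
    (hmem : ∀ t ∈ Icc (0 : ℝ) 1, c t ∈ (extChartAt I z).target) :
    pathELength I ((extChartAt I z).symm ∘ c) 0 1 =
      ∫⁻ t in Ioo (0 : ℝ) 1, ‖chartSymmDeriv I z (c t) (deriv c t)‖ₑ := by
  rw [pathELength_eq_lintegral_mfderiv_Ioo]
  refine setLIntegral_congr_fun measurableSet_Ioo fun t ht ↦ ?_
  have h1 : DifferentiableAt ℝ c t :=
    (hc.differentiableOn one_ne_zero).differentiableAt (Icc_mem_nhds ht.1 ht.2)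
  have h2 := (hasMFDerivAt_chart_symm (I := I) (hmem t (Ioo_subset_Icc_self ht))).comp t
    h1.hasFDerivAt.hasMFDerivAt
  rw [h2.mfderiv]
  have : deriv c t = fderiv ℝ c t 1 := fderiv_apply_one_eq_deriv.symm
  rw [this]
  rfl

variable [IsRiemannianManifold I M]

lemma edist_extChartAt_symm_le {z : M} {c : ℝ → E} (hc : ContDiffOn ℝ 1 c (Icc 0 1))
    (hmem : ∀ t ∈ Icc (0 : ℝ) 1, c t ∈ (extChartAt I z).target) :
    edist ((extChartAt I z).symm (c 0)) ((extChartAt I z).symm (c 1)) ≤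
      ∫⁻ t in Ioo (0 : ℝ) 1, ‖chartSymmDeriv I z (c t) (deriv c t)‖ₑ := by
  rw [← pathELength_extChartAt_symm_comp hc hmem]
  refine edist_le_pathELength (γ := (extChartAt I z).symm ∘ c) ?_ zero_le_one
  exact (contMDiffOn_extChartAt_symm z).comp (contMDiffOn_iff_contDiffOn.2 hc) hmem

variable [FiniteDimensional ℝ E]
  [IsContMDiffRiemannianBundle I ∞ E (fun x : M ↦ TangentSpace I x)]

/-- The derivative of the inverse chart is invertible, and the norm of its inverse controls `c`.
This is the coercivity required by `eventually_eulerPullback_le`. -/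
lemma exists_mul_sq_norm_le_chartMetric {z : M} {u : E} (hu : u ∈ (extChartAt I z).target) :
    ∃ c > 0, ∀ v, c * ‖v‖ ^ 2 ≤ chartMetric I z u v v := by
  obtain ⟨e, he⟩ := isInvertible_chartSymmDeriv (I := I) hu
  set B : TangentSpace I ((extChartAt I z).symm u) →L[ℝ] E :=
    e.symm.toContinuousLinearMap with hB
  have h0 : 0 < ‖B‖ + 1 := by positivity
  refine ⟨1 / (‖B‖ + 1) ^ 2, by positivity, fun v ↦ ?_⟩
  rw [chartMetric_apply, real_inner_self_eq_norm_sq, one_div, inv_mul_le_iff₀ (by positivity),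
    ← mul_pow]
  gcongr
  have h1 : B (chartSymmDeriv I z u v) = v := by
    rw [← he]
    exact e.symm_apply_apply v
  calc ‖v‖ = ‖B (chartSymmDeriv I z u v)‖ := by rw [h1]
    _ ≤ ‖B‖ * ‖chartSymmDeriv I z u v‖ := B.le_opNorm _
    _ ≤ _ := by gcongr; linarith

set_option synthInstance.maxHeartbeats 400000 in
lemma exists_eventually_norm_chartSymmDeriv_le (z : M) :
    ∃ C : ℝ≥0, ∀ᶠ u in 𝓝 (extChartAt I z z), ∀ v, ‖chartSymmDeriv I z u v‖ ≤ C * ‖v‖ := by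
  have h0 : 0 ≤ ‖chartMetric I z (extChartAt I z z)‖ + 1 := by positivity
  refine ⟨(√(‖chartMetric I z (extChartAt I z z)‖ + 1)).toNNReal, ?_⟩
  filter_upwards [eventually_norm_sub_le_of_continuousAt
    (W := E →L[ℝ] E →L[ℝ] ℝ)
    (contDiffAt_chartMetric (I := I) z).continuousAt one_pos] with u hu v
  have h1 : ‖chartMetric I z u‖ ≤ ‖chartMetric I z (extChartAt I z z)‖ + 1 := by
    linarith [norm_sub_norm_le (chartMetric I z u) (chartMetric I z (extChartAt I z z))]
  have h2 := (le_abs_self _).trans (abs_bilinear_apply_self_le _ h1 v)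
  rw [chartMetric_apply, real_inner_self_eq_norm_sq] at h2
  refine le_of_sq_le_sq ?_ (mul_nonneg (NNReal.coe_nonneg _) (norm_nonneg _))
  rw [mul_pow, Real.coe_toNNReal _ (Real.sqrt_nonneg _), Real.sq_sqrt h0]
  exact h2

/-- The image of the segment from `u` to `u'` is a competitor for the Riemannian distance, and its
speed is at most `C` times the chart speed. -/
lemma exists_eventually_dist_extChartAt_symm_le (z : M) :
    ∃ C : ℝ≥0, ∃ ρ > 0, ∀ u ∈ Metric.ball (extChartAt I z z) ρ,
      ∀ u' ∈ Metric.ball (extChartAt I z z) ρ,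
        dist ((extChartAt I z).symm u) ((extChartAt I z).symm u') ≤ C * dist u u' := by
  obtain ⟨C, hC⟩ := exists_eventually_norm_chartSymmDeriv_le (I := I) z
  obtain ⟨ρ, hρ, hsub⟩ := Metric.eventually_nhds_iff_ball.1
    (hC.and (extChartAt_target_mem_nhds (I := I) z))
  refine ⟨C, ρ, hρ, fun u hu u' hu' ↦ ?_⟩
  set c : ℝ → E := fun t ↦ u + t • (u' - u) with hc
  have hmem (t : ℝ) (ht : t ∈ Icc (0 : ℝ) 1) : c t ∈ Metric.ball (extChartAt I z z) ρ :=
    (convex_ball _ _).add_smul_sub_mem hu hu' ht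
  have hd (t : ℝ) : deriv c t = u' - u := by
    have : HasDerivAt c (u' - u) t :=
      (((hasDerivAt_id t).smul_const (u' - u)).const_add u).congr_deriv (one_smul _ _)
    exact this.deriv
  have hcd : ContDiff ℝ 1 c := by fun_prop
  have h1 := edist_extChartAt_symm_le hcd.contDiffOn fun t ht ↦ (hsub _ (hmem t ht)).2
  have h2 : ∫⁻ t in Ioo (0 : ℝ) 1, ‖chartSymmDeriv I z (c t) (deriv c t)‖ₑ ≤
      ∫⁻ _ in Ioo (0 : ℝ) 1, C * edist u u' := by
    refine setLIntegral_mono' measurableSet_Ioo fun t ht ↦ ?_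
    have h3 := (hsub _ (hmem t (Ioo_subset_Icc_self ht))).1 (deriv c t)
    rw [hd, norm_sub_rev u' u] at h3
    have h4 : ‖chartSymmDeriv I z (c t) (u' - u)‖₊ ≤ C * ‖u - u'‖₊ := h3
    rw [hd, edist_eq_enorm_sub, enorm_eq_nnnorm, enorm_eq_nnnorm]
    exact_mod_cast h4
  have h4 := h1.trans h2
  simp only [hc, zero_smul, add_zero, one_smul, add_sub_cancel] at h4
  simp only [lintegral_const, MeasurableSet.univ, Measure.restrict_apply, univ_inter,
    Real.volume_Ioo, sub_zero, ENNReal.ofReal_one, mul_one] at h4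
  rw [edist_nndist, edist_nndist] at h4
  exact_mod_cast h4

/-- In the chart the Euler step is the tangent line of the integral curve, so they differ by o(s),
and the inverse chart is locally Lipschitz. The neighbourhood of `z` depends on neither `γ` nor `ε`.
-/
lemma eventually_dist_eulerStep_le (z : M) (F : Π x : M, TangentSpace I x) :
    ∀ᶠ x in 𝓝 z, ∀ γ : ℝ → M, γ 0 = x → IsMIntegralCurve γ F → ∀ ε > 0,
      ∀ᶠ s in 𝓝[>] (0 : ℝ), dist (γ s) (eulerStep z F s x) ≤ ε * s := by
  obtain ⟨C, ρ, hρ, hC⟩ := exists_eventually_dist_extChartAt_symm_le (I := I) z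
  filter_upwards [extChartAt_source_mem_nhds (I := I) z,
    (continuousAt_extChartAt (I := I) z).eventually (Metric.ball_mem_nhds _ hρ)] with x hx hxρ
  rintro γ rfl hγ ε hε
  set u := extChartAt I z (γ 0) with hu
  have h1 : HasDerivAt (extChartAt I z ∘ γ) (chartField z F u) 0 := hasDerivAt_extChartAt_comp hγ hx
  have h2 : Tendsto (fun s : ℝ ↦ u + s • chartField z F u) (𝓝 0) (𝓝 u) := by
    have : Continuous fun s : ℝ ↦ u + s • chartField z F u := by fun_prop
    exact this.tendsto' _ _ (by simp)
  have h3 : ∀ᶠ s in 𝓝 (0 : ℝ), extChartAt I z (γ s) ∈ Metric.ball (extChartAt I z z) ρ :=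
    h1.continuousAt.eventually (Metric.isOpen_ball.mem_nhds hxρ)
  have h4 : ∀ᶠ s in 𝓝 (0 : ℝ), u + s • chartField z F u ∈ Metric.ball (extChartAt I z z) ρ :=
    h2.eventually (Metric.isOpen_ball.mem_nhds hxρ)
  have h5 : ∀ᶠ s in 𝓝 (0 : ℝ), γ s ∈ (extChartAt I z).source :=
    (hγ 0).continuousAt.eventually ((isOpen_extChartAt_source (I := I) z).mem_nhds hx)
  have h6 := h1.isLittleO.def (show 0 < ε / (C + 1) by positivity)
  filter_upwards [nhdsWithin_le_nhds h3, nhdsWithin_le_nhds h4, nhdsWithin_le_nhds h5,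
    nhdsWithin_le_nhds h6, self_mem_nhdsWithin] with s h3 h4 h5 h6 hs
  have h7 := hC _ h3 _ h4
  rw [(extChartAt I z).left_inv h5] at h7
  refine h7.trans ?_
  have h8 : dist (extChartAt I z (γ s)) (u + s • chartField z F u) ≤ ε / (C + 1) * s := by
    rw [dist_eq_norm]
    have : ‖s - 0‖ = s := by rw [sub_zero, Real.norm_of_nonneg (mem_Ioi.1 hs).le]
    rw [this] at h6
    refine le_of_eq_of_le ?_ h6
    simp [hu, sub_sub]
  have hs' : 0 < s := hs
  calc C * dist (extChartAt I z (γ s)) (u + s • chartField z F u)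
      ≤ (C + 1) * (ε / (C + 1) * s) := by gcongr; simp
    _ = ε * s := by field_simp

end ChartEstimates

/-! ### Expansion of distances by Euler steps and by the flow -/

section FlowEstimates

open scoped NNReal ENNReal
open MeasureTheory

variable {E : Type*} [NormedAddCommGroup E] [NormedSpace ℝ E] [FiniteDimensional ℝ E]
  {H : Type*} [TopologicalSpace H] {I : ModelWithCorners ℝ E H} [I.Boundaryless]
  {M : Type*} [PseudoMetricSpace M] [ChartedSpace H M] [IsManifold I ∞ M]
  [RiemannianBundle (fun x : M ↦ TangentSpace I x)]
  [IsContMDiffRiemannianBundle I ∞ E (fun x : M ↦ TangentSpace I x)]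
  [IsRiemannianManifold I M]
  {F : Π x : M, TangentSpace I x}

lemma eventually_norm_chartSymmDeriv_euler_le (hF : ContMDiff I I.tangent ∞ (T% F)) {L : ℝ}
    (hL : 0 ≤ L) (hFL : ∀ x, ‖leviCivita I M F x‖ ≤ L) {K : ℝ} (hK : L < K) (z : M) :
    ∀ᶠ p : ℝ × E in 𝓝 (0, extChartAt I z z), 0 ≤ p.1 → ∀ v,
      ‖chartSymmDeriv I z (p.2 + p.1 • chartField z F p.2)
        (v + p.1 • fderiv ℝ (chartField z F) p.2 v)‖ ≤
          (1 + K * p.1) * ‖chartSymmDeriv I z p.2 v‖ := by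
  have : CompleteSpace E := FiniteDimensional.complete ℝ E
  have hz := mem_extChartAt_target (I := I) z
  obtain ⟨c, hc, hpos⟩ := exists_mul_sq_norm_le_chartMetric (I := I) hz
  have hK0 : 0 ≤ K := hL.trans hK.le
  have h1 := eventually_eulerPullback_le (G := chartMetric I z) (f := chartField z F)
    ((contDiffAt_chartMetric z).of_le (by simp))
    ((contDiffAt_chartField z hF.contMDiffAt).of_le (WithTop.coe_le_coe.2 le_top)) hc hpos
    -- The constants double because the metric is quadratic; taking roots uses 1 + 2Ks ≤ (1 + Ks)².
    (K := 2 * L) (K' := 2 * K) (by positivity) (fun v ↦ ?_) (by linarith)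
  · filter_upwards [h1] with p hp h0 v
    have h2 := hp h0 v
    rw [chartMetric_apply, chartMetric_apply, real_inner_self_eq_norm_sq,
      real_inner_self_eq_norm_sq] at h2
    refine le_of_sq_le_sq (h2.trans ?_) (by positivity)
    rw [mul_pow]
    gcongr
    nlinarith [mul_nonneg hK0 h0]
  · rw [lie_chartMetric_apply z v hF.contMDiffAt, chartMetric_apply, real_inner_self_eq_norm_sq,
      mul_assoc]
    set w := chartSymmDeriv I z (extChartAt I z z) v
    gcongr
    calc inner ℝ (leviCivita I M F ((extChartAt I z).symm (extChartAt I z z)) w) w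
        ≤ ‖leviCivita I M F ((extChartAt I z).symm (extChartAt I z z)) w‖ * ‖w‖ :=
          real_inner_le_norm _ _
      _ ≤ L * ‖w‖ * ‖w‖ := by
          gcongr
          exact ContinuousLinearMap.le_of_opNorm_le _ (hFL _) w
      _ = L * ‖w‖ ^ 2 := by ring

/-- Close to `z`, the Euler step of size `s` expands distances by a factor of at most `1 + K * s`,
for every `K` larger than the supremum of `‖∇ F‖`. -/
lemma exists_dist_eulerStep_eulerStep_le (hF : ContMDiff I I.tangent ∞ (T% F)) {L : ℝ}
    (hL : 0 ≤ L) (hFL : ∀ x, ‖leviCivita I M F x‖ ≤ L) {K : ℝ} (hK : L < K) (z : M) :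
    ∃ δ > 0, ∀ᶠ s in 𝓝[>] (0 : ℝ), ∀ x ∈ Metric.ball z δ, ∀ y ∈ Metric.ball z δ,
      dist (eulerStep z F s x) (eulerStep z F s y) ≤ (1 + K * s) * dist x y := by
  have : CompleteSpace E := FiniteDimensional.complete ℝ E
  set f := chartField z F with hf
  set u₀ := extChartAt I z z with hu₀
  have hfd : ContDiffAt ℝ 1 f u₀ :=
    (contDiffAt_chartField z hF.contMDiffAt).of_le (by simp)
  have hsnd : Tendsto (fun p : ℝ × E ↦ p.2) (𝓝 (0, u₀)) (𝓝 u₀) := continuous_snd.tendsto' _ _ rfl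
  have e1 : ∀ᶠ p : ℝ × E in 𝓝 (0, u₀), ContDiffAt ℝ 1 f p.2 :=
    hsnd.eventually (hfd.eventually (by simp))
  have e2 : ∀ᶠ p : ℝ × E in 𝓝 (0, u₀), p.2 + p.1 • f p.2 ∈ (extChartAt I z).target := by
    have h1 : ContinuousAt (fun p : ℝ × E ↦ p.2 + p.1 • f p.2) (0, u₀) :=
      continuousAt_snd.add (continuousAt_fst.smul
        (ContinuousAt.comp (g := f) hfd.continuousAt continuousAt_snd))
    have h2 : (fun p : ℝ × E ↦ p.2 + p.1 • f p.2) (0, u₀) = u₀ := by simp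
    refine h1.eventually ?_
    rw [h2]
    exact extChartAt_target_mem_nhds (I := I) z
  have e3 := (eventually_norm_chartSymmDeriv_euler_le hF hL hFL hK z).and (e1.and e2)
  rw [nhds_prod_eq] at e3
  obtain ⟨pa, ha, pb, hb, hab⟩ := eventually_prod_iff.1 e3
  have e4 : ∀ᶠ x in 𝓝 z, x ∈ (extChartAt I z).source ∧ pb (extChartAt I z x) :=
    Eventually.and (extChartAt_source_mem_nhds (I := I) z)
      ((continuousAt_extChartAt (I := I) z).eventually hb)
  obtain ⟨δ, hδ, hsub⟩ := Metric.eventually_nhds_iff_ball.1 e4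
  -- Points within `δ / 3` of `z` are less than `2 * (δ / 3)` apart, so a curve of smaller length
  -- joining them stays in the ball of radius `δ`, where the chart estimates hold.
  refine ⟨δ / 3, by positivity, ?_⟩
  filter_upwards [nhdsWithin_le_nhds ha, self_mem_nhdsWithin] with s hs hs0 x hx y hy
  rw [Metric.mem_ball] at hx hy
  have hs0' : 0 ≤ s := (mem_Ioi.1 hs0).le
  have hK0 : 0 ≤ 1 + K * s := by have := hL.trans hK.le; positivity
  have hxy : dist x y < 2 * (δ / 3) := by
    linarith [dist_triangle_right x y z]
  have key : ∀ r ∈ Ioo (dist x y) (2 * (δ / 3)),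
      dist (eulerStep z F s x) (eulerStep z F s y) ≤ (1 + K * s) * r := by
    intro r hr
    have hr0 : 0 ≤ r := dist_nonneg.trans hr.1.le
    have hr1 : riemannianEDist I x y < ENNReal.ofReal r := by
      rw [← IsRiemannianManifold.out (I := I) x y, edist_dist]
      exact (ENNReal.ofReal_lt_ofReal_iff_of_nonneg dist_nonneg).2 hr.1
    obtain ⟨γ, rfl, rfl, hγ, hlen, -⟩ :=
      exists_lt_locally_constant_of_riemannianEDist_lt hr1 zero_lt_one
    have hball (t : ℝ) (ht : t ∈ Icc (0 : ℝ) 1) : γ t ∈ Metric.ball z δ := by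
      have h1 : edist (γ 0) (γ t) < ENNReal.ofReal r :=
        ((edist_le_pathELength (I := I) hγ.contMDiffOn ht.1).trans
          (pathELength_mono le_rfl ht.2)).trans_lt hlen
      rw [edist_dist, ENNReal.ofReal_lt_ofReal_iff_of_nonneg dist_nonneg] at h1
      rw [Metric.mem_ball]
      linarith [dist_triangle_left (γ t) z (γ 0), hr.2]
    set c : ℝ → E := extChartAt I z ∘ γ with hc
    have hsrc (t : ℝ) (ht : t ∈ Icc (0 : ℝ) 1) : γ t ∈ (extChartAt I z).source :=
      (hsub _ (hball t ht)).1
    have hcd : ContDiffOn ℝ 1 c (Icc 0 1) := by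
      rw [← contMDiffOn_iff_contDiffOn]
      exact (contMDiffOn_extChartAt (n := 1)).comp hγ.contMDiffOn
        fun t ht ↦ by simpa using hsrc t ht
    have hab' (t : ℝ) (ht : t ∈ Icc (0 : ℝ) 1) := hab hs (hsub _ (hball t ht)).2
    set c' : ℝ → E := fun t ↦ c t + s • f (c t) with hc'
    have hcd' : ContDiffOn ℝ 1 c' (Icc 0 1) := by
      refine hcd.add (contDiffOn_const.smul fun t ht ↦ ?_)
      exact (hab' t ht).2.1.comp_contDiffWithinAt t (hcd t ht)
    have h1 := edist_extChartAt_symm_le hcd' fun t ht ↦ (hab' t ht).2.2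
    have h2 : ∫⁻ t in Ioo (0 : ℝ) 1, ‖chartSymmDeriv I z (c' t) (deriv c' t)‖ₑ ≤
        ∫⁻ t in Ioo (0 : ℝ) 1, ENNReal.ofReal (1 + K * s) *
          ‖chartSymmDeriv I z (c t) (deriv c t)‖ₑ := by
      refine setLIntegral_mono' measurableSet_Ioo fun t ht ↦ ?_
      have ht' := Ioo_subset_Icc_self ht
      have h3 : HasDerivAt c (deriv c t) t := ((hcd.differentiableOn one_ne_zero).differentiableAt
        (Icc_mem_nhds ht.1 ht.2)).hasDerivAt
      have h4 : HasDerivAt c' (deriv c t + s • fderiv ℝ f (c t) (deriv c t)) t :=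
        h3.add ((((hab' t ht').2.1.differentiableAt one_ne_zero).hasFDerivAt.comp_hasDerivAt
          t h3).const_smul s)
      have h5 := (hab' t ht').1 hs0' (deriv c t)
      rw [h4.deriv, ← ofReal_norm, ← ofReal_norm, ← ENNReal.ofReal_mul hK0]
      exact ENNReal.ofReal_le_ofReal h5
    have h3 : pathELength I γ 0 1 = pathELength I ((extChartAt I z).symm ∘ c) 0 1 :=
      pathELength_congr fun t ht ↦ ((extChartAt I z).left_inv (hsrc t ht)).symm
    rw [lintegral_const_mul' _ _ ENNReal.ofReal_ne_top, ← pathELength_extChartAt_symm_comp hcd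
      fun t ht ↦ (extChartAt I z).map_source (hsrc t ht), ← h3] at h2
    have h4 : edist (eulerStep z F s (γ 0)) (eulerStep z F s (γ 1)) ≤
        ENNReal.ofReal (1 + K * s) * ENNReal.ofReal r :=
      (h1.trans h2).trans (by gcongr)
    rw [← ENNReal.ofReal_mul hK0, edist_dist] at h4
    exact (ENNReal.ofReal_le_ofReal_iff (by positivity)).1 h4
  have hlim : Tendsto (fun r : ℝ ↦ (1 + K * s) * r) (𝓝[>] (dist x y))
      (𝓝 ((1 + K * s) * dist x y)) :=
    ((continuous_const.mul continuous_id).tendsto _).mono_left nhdsWithin_le_nhds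
  exact ge_of_tendsto hlim (by filter_upwards [Ioo_mem_nhdsGT hxy] with r hr using key r hr)

/-- Close to `z`, the distance between two integral curves grows at rate at most `K`, for every `K`
larger than the supremum of `‖∇ F‖`. -/
lemma exists_dist_sub_lt_mul (hF : ContMDiff I I.tangent ∞ (T% F)) {L : ℝ}
    (hL : 0 ≤ L) (hFL : ∀ x, ‖leviCivita I M F x‖ ≤ L) {K : ℝ} (hK : L < K) (z : M) :
    ∃ δ > 0, ∀ γ η : ℝ → M, IsMIntegralCurve γ F → IsMIntegralCurve η F →
      γ 0 ∈ Metric.ball z δ → η 0 ∈ Metric.ball z δ → ∀ r, K * dist (γ 0) (η 0) < r →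
        ∀ᶠ s in 𝓝[>] (0 : ℝ), dist (γ s) (η s) - dist (γ 0) (η 0) < r * s := by
  obtain ⟨δ₁, hδ₁, h1⟩ := exists_dist_eulerStep_eulerStep_le hF hL hFL hK z
  obtain ⟨δ₂, hδ₂, h2⟩ := Metric.eventually_nhds_iff_ball.1 (eventually_dist_eulerStep_le z F)
  refine ⟨min δ₁ δ₂, lt_min hδ₁ hδ₂, fun γ η hγ hη hγ0 hη0 r hr ↦ ?_⟩
  have hb1 := Metric.ball_subset_ball (x := z) (min_le_left δ₁ δ₂)
  have hb2 := Metric.ball_subset_ball (x := z) (min_le_right δ₁ δ₂)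
  obtain ⟨ε, hε, hεr⟩ : ∃ ε > 0, K * dist (γ 0) (η 0) + 2 * ε < r :=
    ⟨(r - K * dist (γ 0) (η 0)) / 3, by linarith, by linarith⟩
  filter_upwards [h1, h2 _ (hb2 hγ0) γ rfl hγ ε hε, h2 _ (hb2 hη0) η rfl hη ε hε,
    self_mem_nhdsWithin] with s h1 h2 h3 hs
  have h4 := h1 _ (hb1 hγ0) _ (hb1 hη0)
  have h5 := dist_triangle4 (γ s) (eulerStep z F s (γ 0)) (eulerStep z F s (η 0)) (η s)
  rw [dist_comm (eulerStep z F s (η 0)) (η s)] at h5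
  have h6 := mul_lt_mul_of_pos_right hεr (mem_Ioi.1 hs)
  linarith

/-- Integral curves starting close to a given point separate at most exponentially. -/
lemma eventually_dist_flow_le (hF : ContMDiff I I.tangent ∞ (T% F)) {L : ℝ}
    (hL : 0 ≤ L) (hFL : ∀ x, ‖leviCivita I M F x‖ ≤ L) {K : ℝ} (hK : L < K)
    (hFc : IsCompleteVectorField F) {T : ℝ} (hT : 0 ≤ T) (x : M) :
    ∀ᶠ y in 𝓝 x, dist (flow hFc T x) (flow hFc T y) ≤ Real.exp (K * T) * dist x y := by
  have hK0 : 0 ≤ K := hL.trans hK.le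
  choose δ hδ hloc using exists_dist_sub_lt_mul hF hL hFL hK
  have hcont (y : M) : Continuous fun t ↦ flow hFc t y :=
    continuous_iff_continuousAt.2 fun t ↦ (isMIntegralCurve_flow hFc y t).continuousAt
  have hcpt : IsCompact ((fun t ↦ flow hFc t x) '' Icc 0 T) := isCompact_Icc.image (hcont x)
  -- The Lebesgue number is the Gronwall threshold: while the curves are closer than `ρ`, both lie
  -- in one ball where the local growth estimate applies.
  obtain ⟨ρ, hρ, hρδ⟩ := lebesgue_number_lemma_of_metric hcpt
    (c := fun z ↦ Metric.ball z (δ z)) (fun z ↦ Metric.isOpen_ball)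
    (fun z _ ↦ mem_iUnion.2 ⟨z, Metric.mem_ball_self (hδ z)⟩)
  have h0 : Tendsto (fun y ↦ dist x y * Real.exp (K * T)) (𝓝 x) (𝓝 0) := by
    have : Continuous fun y ↦ dist x y * Real.exp (K * T) := by fun_prop
    exact this.tendsto' _ _ (by simp)
  filter_upwards [h0.eventually (gt_mem_nhds hρ)] with y hy
  have key := le_mul_exp_of_frequently_slope_lt (d := fun t ↦ dist (flow hFc t x) (flow hFc t y))
    hT hK0 ((hcont x).dist (hcont y)) (fun _ ↦ dist_nonneg) (δ := ρ) ?_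
    (by simpa only [flow_zero] using hy) T ⟨hT, le_rfl⟩
  · simpa only [flow_zero, mul_comm] using key
  · intro t ht hd r hr
    obtain ⟨z, hz⟩ := hρδ _ (mem_image_of_mem _ (Ico_subset_Icc_self ht))
    have h1 := hloc z _ _ ((isMIntegralCurve_flow hFc x).comp_add t)
      ((isMIntegralCurve_flow hFc y).comp_add t)
      (by simpa using hz (Metric.mem_ball_self hρ))
      (by simpa using hz (Metric.mem_ball'.2 hd)) r (by simpa using hr)
    simpa [add_comm] using h1

/-- The flow of a vector field with `‖∇ F‖ ≤ L` separates points at most like `exp (L * t)`. -/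
theorem dist_flow_le (hF : ContMDiff I I.tangent ∞ (T% F)) {L : ℝ}
    (hL : 0 ≤ L) (hFL : ∀ x, ‖leviCivita I M F x‖ ≤ L) (hFc : IsCompleteVectorField F) {T : ℝ}
    (hT : 0 ≤ T) (x y : M) :
    dist (flow hFc T x) (flow hFc T y) ≤ Real.exp (L * T) * dist x y := by
  have key (K : ℝ) (hK : L < K) :
      dist (flow hFc T x) (flow hFc T y) ≤ Real.exp (K * T) * dist x y := by
    have h1 : LipschitzWith (Real.exp (K * T)).toNNReal (flow hFc T) := by
      refine lipschitzWith_of_eventually_edist_le I fun x ↦ ?_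
      filter_upwards [eventually_dist_flow_le hF hL hFL hK hFc hT x] with y hy
      rw [edist_dist, edist_dist, ← ENNReal.ofReal, ← ENNReal.ofReal_mul (Real.exp_pos _).le]
      exact ENNReal.ofReal_le_ofReal hy
    simpa [Real.coe_toNNReal _ (Real.exp_pos _).le] using h1.dist_le_mul x y
  have hlim : Tendsto (fun K : ℝ ↦ Real.exp (K * T) * dist x y) (𝓝[>] L)
      (𝓝 (Real.exp (L * T) * dist x y)) := by
    have : Continuous fun K : ℝ ↦ Real.exp (K * T) * dist x y := by fun_prop
    exact (this.tendsto _).mono_left nhdsWithin_le_nhds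
  exact ge_of_tendsto hlim (by filter_upwards [self_mem_nhdsWithin] with K hK using key K hK)

end FlowEstimates

/-- The flow is defined by choosing integral curves, so the group law rests on their uniqueness,
`eq_flow`. -/
lemma flow_add {E : Type*} [NormedAddCommGroup E] [NormedSpace ℝ E] [CompleteSpace E]
    {H : Type*} [TopologicalSpace H] {I : ModelWithCorners ℝ E H} [I.Boundaryless]
    {M : Type*} [TopologicalSpace M] [T2Space M] [ChartedSpace H M] [IsManifold I 1 M]
    {F : Π x : M, TangentSpace I x} (hFc : IsCompleteVectorField F)
    (hF : ContMDiff I I.tangent 1 (T% F)) (s t : ℝ) (x : M) :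
    flow hFc (s + t) x = flow hFc s (flow hFc t x) := by
  have h := eq_flow hFc hF ((isMIntegralCurve_flow hFc x).comp_add t) s
  simpa using h

end RiemannianError
end

theorem mainTheorem1
    {E : Type*} [NormedAddCommGroup E] [NormedSpace ℝ E] [FiniteDimensional ℝ E]
    {H : Type*} [TopologicalSpace H] {I : ModelWithCorners ℝ E H} [I.Boundaryless]
    {M : Type*} [MetricSpace M] [ConnectedSpace M] [ChartedSpace H M] [IsManifold I ∞ M]
    [RiemannianBundle (fun x : M ↦ TangentSpace I x)]
    [IsContMDiffRiemannianBundle I ∞ E (fun x : M ↦ TangentSpace I x)]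
    [IsRiemannianManifold I M]
    (F : Π x : M, TangentSpace I x)
    (hF : ContMDiff I I.tangent ∞ (fun x ↦ (⟨x, F x⟩ : TangentBundle I M)))
    (hFc : RiemannianError.IsCompleteVectorField F)
    (L : ℝ) (hL : 0 < L) (hFL : ∀ x : M, ‖RiemannianError.leviCivita I M F x‖ ≤ L)
    (ψ : ℝ → M → M) (C : ℝ) (p : ℕ) :
    ∀ h : ℝ, 0 < h →
      (∀ u : M, dist (ψ h u) (RiemannianError.flow hFc h u) ≤ C * h ^ (p + 1)) →
      ∀ u : ℕ → M, (∀ k, u (k + 1) = ψ h (u k)) →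
        ∀ k : ℕ, 0 < k →
          dist (RiemannianError.flow hFc (k * h) (u 0)) (u k) ≤
            C / L * (Real.exp (k * h * L) - 1) * h ^ p := by
  intro h hh hψ u hu k _
  have : CompleteSpace E := FiniteDimensional.complete ℝ E
  -- The sign of `C` is forced: `C * h ^ (p + 1)` bounds a distance.
  have hC : 0 ≤ C := by
    have := dist_nonneg.trans (hψ (u 0))
    exact nonneg_of_mul_nonneg_left this (by positivity)
  refine RiemannianError.le_of_forall_succ_le_exp_mul_add
    (e := fun k ↦ dist (RiemannianError.flow hFc (k * h) (u 0)) (u k)) hC hL hh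
    (by simp [RiemannianError.flow_zero]) (fun k ↦ ?_) k
  have h1 : RiemannianError.flow hFc ((k + 1 : ℕ) * h) (u 0) =
      RiemannianError.flow hFc h (RiemannianError.flow hFc (k * h) (u 0)) := by
    rw [← RiemannianError.flow_add hFc (hF.of_le (by simp))]
    congr 1
    push_cast
    ring
  rw [h1, hu k]
  refine (dist_triangle _ (RiemannianError.flow hFc h (u k)) _).trans (add_le_add ?_ ?_)
  · exact RiemannianError.dist_flow_le hF hL.le hFL hFc hh.le _ _
  · rw [dist_comm]
    exact hψ _
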